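/- Let $n\ge 1$ and let $\nu$ be a measure on $\mathbb{R}^n$ with a density $\psi:\mathbb{R}^n\to[0,\infty)$ with respect to Lebesgue measure. Assume that $\psi$ is even and $\gamma$-concave for some real $\gamma\ge -\frac{1}{n+1}$; that is, $\psi$ is not identically zero, the set $\{\psi>0\}$ is convex, and on this set $\psi^\gamma$ is concave if $\gamma>0$, $\log\psi$ is concave if $\gamma=0$, and $\psi^\gamma$ is convex if $\gamma<0$. Let $(K_t)_{t\in\mathbb{R}}$ be a shadow system of convex sets in $\mathbb{R}^n$: there are a closed convex set $C\subset\mathbb{R}^n\times\mathbb{R}$ and a vector $\theta\in\mathbb{R}^n$ with $|\theta|=1$ such that, for every $t\in\mathbb{R}$, $$K_t=\{x+ts\,\theta \,:\, (x,s)\in C\}.$$ Assume that every $K_t$ is symmetric about the origin, $K_t=-K_t$. Let $K_t^\circ=\{y\in\mathbb{R}^n : \langle x,y\rangle\le 1 \text{ for all } x\in K_t\}$ be the polar of $K_t$. Then the function $$t\mapsto \nu(K_t^\circ)^{-1}$$ from $\mathbb{R}$ to $[0,\infty]$ (with the conventions $0^{-1}=\infty$ and $\infty^{-1}=0$) is convex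 on $\mathbb{R}$. -/

import Mathlib

open MeasureTheory Set
open scoped NNReal ENNReal Pointwise

namespace CampiGronchi

/-- `γ`-concavity of a nonnegative, not identically zero function `ψ`. Convexity of the set
`{ψ > 0}` is part of `ConcaveOn` and `ConvexOn`. -/
def IsGammaConcave {E : Type*} [AddCommGroup E] [Module ℝ E] (γ : ℝ) (ψ : E → ℝ) : Prop :=
  (∀ x, 0 ≤ ψ x) ∧ (∃ x, ψ x ≠ 0) ∧
    (0 < γ → ConcaveOn ℝ {x | 0 < ψ x} (fun x => ψ x ^ γ)) ∧
    (γ = 0 → ConcaveOn ℝ {x | 0 < ψ x} (fun x => Real.log (ψ x))) ∧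
    (γ < 0 → ConvexOn ℝ {x | 0 < ψ x} (fun x => ψ x ^ γ))

/-- The support function `h_K(x) = sup {⟪y, x⟫ : y ∈ K}`, with values in `[-∞, +∞]`. -/
noncomputable def supportFn {E : Type*} [NormedAddCommGroup E] [InnerProductSpace ℝ E]
    (K : Set E) (x : E) : EReal :=
  ⨆ y ∈ K, ((inner ℝ y x : ℝ) : EReal)

/-- The polar `K° = {y : h_K(y) ≤ 1}`. -/
def polar {E : Type*} [NormedAddCommGroup E] [InnerProductSpace ℝ E] (K : Set E) : Set E :=
  {y | supportFn K y ≤ 1}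

theorem mem_polar_iff {E : Type*} [NormedAddCommGroup E] [InnerProductSpace ℝ E]
    (K : Set E) (y : E) : y ∈ polar K ↔ ∀ x ∈ K, inner ℝ x y ≤ (1 : ℝ) := by
  simp only [polar, supportFn, mem_ofPred_eq, iSup_le_iff]
  exact forall₂_congr fun x _ => by exact_mod_cast Iff.rfl

/-- The projection `P_t` of `E ⊕ ℝ e` onto `E` parallel to `e - t θ`, namely
`P_t (x + s e) = x + t s θ`; the point `x + s e` is written as the pair `(x, s)`. -/
def shadowProj {E : Type*} [AddCommGroup E] [Module ℝ E] (θ : E) (t : ℝ) (p : E × ℝ) : E :=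
  p.1 + (t * p.2) • θ

/-- A shadow system of convex sets: the family `K_t = P_t C`, `t ∈ ℝ`, for a closed convex set
`C` in `E ⊕ ℝ` and a unit vector `θ` of `E`. -/
def IsShadowSystem {E : Type*} [NormedAddCommGroup E] [NormedSpace ℝ E] (K : ℝ → Set E) : Prop :=
  ∃ (C : Set (E × ℝ)) (θ : E), IsClosed C ∧ Convex ℝ C ∧ ‖θ‖ = 1 ∧
    ∀ t, K t = shadowProj θ t '' C

end CampiGronchi

/-!
The measure `ν(K_t°)` is twice the measure of the half of `K_t°` in `{⟪x, θ⟫ > 0}`, since both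
`ψ` and `K_t°` are even. On that half-space use the projective coordinates `(p, w)` with `p > 0`,
`w ∈ θ^⊥` and `x = p⁻¹ (θ + w)`; Lebesgue measure becomes `p ^ (-(n + 1)) dp dw`
(`exists_lintegral_eq_projDensity`).

These coordinates linearize the problem. The point `p⁻¹ (θ + w)` lies in `K_t°` if and only if
`⟪x, θ + w⟫ + t s ≤ p` for all `(x, s) ∈ C`, and these conditions are jointly affine in `(p, w, t)`
(`inv_smul_mem_polar_shadow_iff`). The density is `φ(p, w) = p ^ (-(n + 1)) ψ(p⁻¹ (θ + w))`, and
`φ ^ (-1 / (n + 1)) = p ψ(p⁻¹ (θ + w)) ^ (-1 / (n + 1))` is the perspective of a convex function,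
hence convex, because a `γ`-concave function with `γ ≥ -1 / (n + 1)` is also
`-1 / (n + 1)`-concave (`IsGammaConcave.convexOn_rpow_neg`). So the densities of the half polars are
jointly `-1 / (n + 1)`-concave in `(p, w, t)` (`projDensity_polar_rpow_le`), and the
Borell–Brascamp–Lieb inequality in dimension `n` (`borell_brascamp_lieb`) says that their integrals
are `-1`-concave in `t`, that is, that the inverses of the integrals are convex.

The Borell–Brascamp–Lieb inequality is proved by induction on the dimension. On the line, the
superlevel sets of the functions, normalized by their suprema, satisfy the Brunn–Minkowski
inequality; integrating over the levels and applying Hölder's inequality gives the claim. The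
inequalities are stated for functions with values in `[0, ∞]` in terms of the powers of exponent
`-p`, which are infinite where the functions vanish.
-/

namespace CampiGronchi

/-! ### Powers of negative exponent -/

theorem rpow_neg_antitone {p : ℝ} (hp : 0 ≤ p) {x y : ℝ≥0∞} (h : x ≤ y) :
    y ^ (-p) ≤ x ^ (-p) := by
  rw [ENNReal.rpow_neg, ENNReal.rpow_neg]
  exact ENNReal.inv_le_inv.2 (ENNReal.rpow_le_rpow h hp)

theorem le_of_rpow_neg_le {p : ℝ} (hp : 0 < p) {x y : ℝ≥0∞} (h : y ^ (-p) ≤ x ^ (-p)) :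
    x ≤ y := by
  rw [ENNReal.rpow_neg, ENNReal.rpow_neg, ENNReal.inv_le_inv] at h
  exact (ENNReal.rpow_le_rpow_iff hp).1 h

/-! ### Brunn–Minkowski on the line -/

theorem volume_add_le_of_isCompact {K L : Set ℝ} (hK : IsCompact K) (hL : IsCompact L)
    (hK₀ : K.Nonempty) (hL₀ : L.Nonempty) :
    volume K + volume L ≤ volume (K + L) := by
  have hx := hK.sSup_mem hK₀
  have hy := hL.sInf_mem hL₀
  set x := sSup K
  set y := sInf L
  have hKy : volume (y +ᵥ K) = volume K := measure_vadd _ _ _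
  have hxL : volume (x +ᵥ L) = volume L := measure_vadd _ _ _
  have hLm : MeasurableSet (x +ᵥ L) := (hL.vadd x).measurableSet
  -- Two translates, by the last point of `K` and the first point of `L`, meet in one point only.
  have hsub : (y +ᵥ K) ∪ (x +ᵥ L) ⊆ K + L := by
    rintro _ (⟨k, hk, rfl⟩ | ⟨l, hl, rfl⟩)
    · exact ⟨k, hk, y, hy, by simp [add_comm]⟩
    · exact ⟨x, hx, l, hl, rfl⟩
  have hnull : volume ((y +ᵥ K) ∩ (x +ᵥ L)) = 0 := by
    refine measure_mono_null (t := {x + y}) ?_ (by simp)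
    rintro _ ⟨⟨k, hk, rfl⟩, ⟨l, hl, hkl⟩⟩
    have h1 : k ≤ x := le_csSup hK.bddAbove hk
    have h2 : y ≤ l := csInf_le hL.bddBelow hl
    simp only [vadd_eq_add, mem_singleton_iff] at hkl ⊢
    linarith
  calc volume K + volume L = volume (y +ᵥ K) + volume (x +ᵥ L) := by rw [hKy, hxL]
    _ = volume ((y +ᵥ K) ∪ (x +ᵥ L)) := by
        rw [← measure_union_add_inter _ hLm, hnull, add_zero]
    _ ≤ _ := measure_mono hsub

/-- The Brunn–Minkowski inequality on the line. The set `S`, which contains the Minkowski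
combination of `A` and `B`, makes measurability of that combination irrelevant. -/
theorem brunn_minkowski_real {A B S : Set ℝ} (hA : MeasurableSet A) (hB : MeasurableSet B)
    (hA₀ : A.Nonempty) (hB₀ : B.Nonempty) (a b : ℝ≥0)
    (hS : ∀ x ∈ A, ∀ y ∈ B, a • x + b • y ∈ S) :
    a * volume A + b * volume B ≤ volume S := by
  obtain ⟨x₀, hx₀⟩ := hA₀
  obtain ⟨y₀, hy₀⟩ := hB₀
  rw [hA.measure_eq_iSup_isCompact, hB.measure_eq_iSup_isCompact]
  simp only [iSup_and', ENNReal.mul_iSup]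
  refine ENNReal.biSup_add_biSup_le' ⟨∅, by simp⟩ ⟨∅, by simp⟩ ?_
  rintro K ⟨hKA, hK⟩ L ⟨hLB, hL⟩
  have hK' : IsCompact (a • insert x₀ K) := (hK.insert x₀).smul a
  have hL' : IsCompact (b • insert y₀ L) := (hL.insert y₀).smul b
  calc a * volume K + b * volume L
      ≤ a * volume (insert x₀ K) + b * volume (insert y₀ L) := by
        gcongr <;> exact subset_insert _ _
    _ = volume (a • insert x₀ K) + volume (b • insert y₀ L) := by
        simp [Measure.addHaar_nnreal_smul]
    _ ≤ volume (a • insert x₀ K + b • insert y₀ L) :=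
        volume_add_le_of_isCompact hK' hL' (insert_nonempty _ _).smul_set
          (insert_nonempty _ _).smul_set
    _ ≤ volume S := by
        refine measure_mono ?_
        rintro _ ⟨_, ⟨x, hx, rfl⟩, _, ⟨y, hy, rfl⟩, rfl⟩
        exact hS x (insert_subset hx₀ hKA hx) y (insert_subset hy₀ hLB hy)

theorem volume_superlevel_eq_zero {u : ℝ → ℝ} (hu : ∀ x, u x ≤ 1) {s : ℝ} (hs : 1 ≤ s) :
    volume {x | s < u x} = 0 := by
  have : {x | s < u x} = ∅ := by
    ext x; simpa using (hu x).trans hs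
  simp [this]

/-- Integrated form of the Brunn–Minkowski inequality for the superlevel sets of functions
normalized to have supremum one. -/
theorem lintegral_add_le_of_superlevel {f g h : ℝ → ℝ≥0∞} (hf : Measurable f)
    (hg : Measurable g) (hh : Measurable h) (hf₁ : ⨆ x, f x = 1) (hg₁ : ⨆ x, g x = 1)
    (a b : ℝ≥0)
    (H : ∀ x y, ∀ s < min (f x) (g y), s ≤ h (a • x + b • y)) :
    a * (∫⁻ x, f x) + b * (∫⁻ x, g x) ≤ ∫⁻ x, h x := by
  have layer : ∀ {f : ℝ → ℝ≥0∞}, Measurable f → (∀ x, f x ≤ 1) →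
      ∫⁻ x, f x = ∫⁻ s in Ioi (0 : ℝ), volume {x | s < (f x).toReal} := by
    intro f hf h1
    rw [← lintegral_eq_lintegral_meas_lt _ (ae_of_all _ fun x => ENNReal.toReal_nonneg)
      hf.ennreal_toReal.aemeasurable]
    refine lintegral_congr fun x => (ENNReal.ofReal_toReal ?_).symm
    exact ne_top_of_le_ne_top ENNReal.one_ne_top (h1 x)
  have hf1 : ∀ x, f x ≤ 1 := fun x => hf₁ ▸ le_iSup f x
  have hg1 : ∀ x, g x ≤ 1 := fun x => hg₁ ▸ le_iSup g x
  have toReal_le : ∀ {t : ℝ≥0∞}, t ≤ 1 → t.toReal ≤ 1 := fun ht => by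
    simpa using ENNReal.toReal_mono ENNReal.one_ne_top ht
  have hmono : ∀ (f : ℝ → ℝ≥0∞), Measurable fun s : ℝ => volume {x | s < (f x).toReal} := by
    intro f
    refine Antitone.measurable fun s t hst => measure_mono fun x (hx : t < _) => ?_
    exact lt_of_le_of_lt hst hx
  have hmin : ∫⁻ x, min (h x) 1 ≤ ∫⁻ x, h x := lintegral_mono fun x => min_le_left _ _
  -- Superlevel sets of `f` and `g` above height one are empty, so only `min h 1` matters.
  refine le_trans ?_ hmin
  have hw : ∫⁻ x, min (h x) 1
      = ∫⁻ s in Ioi (0 : ℝ), volume {x | s ≤ (min (h x) 1).toReal} := by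
    rw [← lintegral_eq_lintegral_meas_le _ (ae_of_all _ fun x => ENNReal.toReal_nonneg)
      (hh.min measurable_const).ennreal_toReal.aemeasurable]
    refine lintegral_congr fun x => (ENNReal.ofReal_toReal ?_).symm
    exact ne_top_of_le_ne_top ENNReal.one_ne_top (min_le_right _ _)
  rw [layer hf hf1, layer hg hg1, hw, ← lintegral_const_mul _ (hmono f),
    ← lintegral_const_mul _ (hmono g), ← lintegral_add_left ((hmono f).const_mul _)]
  refine setLIntegral_mono' measurableSet_Ioi fun s (hs : 0 < s) => ?_
  rcases le_or_gt 1 s with hs1 | hs1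
  · rw [volume_superlevel_eq_zero (fun x => toReal_le (hf1 x)) hs1,
      volume_superlevel_eq_zero (fun x => toReal_le (hg1 x)) hs1]
    simp
  have hlt : ∀ {t : ℝ≥0∞}, t ≤ 1 → (s < t.toReal ↔ ENNReal.ofReal s < t) := fun {t} ht =>
    (ENNReal.ofReal_lt_iff_lt_toReal hs.le (ne_top_of_le_ne_top ENNReal.one_ne_top ht)).symm
  have hne : ∀ {f : ℝ → ℝ≥0∞}, (∀ x, f x ≤ 1) → ⨆ x, f x = 1 →
      {x | s < (f x).toReal}.Nonempty := by
    intro f h1 hsup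
    have : ENNReal.ofReal s < ⨆ x, f x := by rw [hsup]; simpa using hs1
    obtain ⟨x, hx⟩ := lt_iSup_iff.1 this
    exact ⟨x, (hlt (h1 x)).2 hx⟩
  refine brunn_minkowski_real (measurableSet_lt measurable_const hf.ennreal_toReal)
    (measurableSet_lt measurable_const hg.ennreal_toReal) (hne hf1 hf₁) (hne hg1 hg₁) a b ?_
  intro x hx y hy
  have h1 : ENNReal.ofReal s ≤ h (a • x + b • y) :=
    H x y _ (lt_min ((hlt (hf1 x)).1 hx) ((hlt (hg1 y)).1 hy))
  have h2 : ENNReal.ofReal s ≤ min (h (a • x + b • y)) 1 :=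
    le_min h1 (by simpa using hs1.le)
  exact (ENNReal.ofReal_le_iff_le_toReal
    (ne_top_of_le_ne_top ENNReal.one_ne_top (min_le_right _ _))).1 h2

/-! ### The Borell–Brascamp–Lieb inequality -/

/-- Hölder's inequality for two-point means: the product of a mean of exponent `-p` and an
arithmetic mean dominates the mean of exponent `-p / (1 - p)` of the products. -/
theorem holder_two_point {p : ℝ} (hp : 0 < p) (hp1 : p < 1) {a b : ℝ≥0} (ha : a ≠ 0) {A B c d : ℝ≥0∞}
    (hA : A ≠ 0) (hA' : A ≠ ⊤) (hB : B ≠ 0) (hB' : B ≠ ⊤) (hc : c ≠ 0) (hc' : c ≠ ⊤)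
    (hd : d ≠ 0) (hd' : d ≠ ⊤) :
    ((a * A ^ (-p) + b * B ^ (-p)) ^ (-(1 / p)) * (a * c + b * d)) ^ (-(p / (1 - p)))
      ≤ a * (A * c) ^ (-(p / (1 - p))) + b * (B * d) ^ (-(p / (1 - p))) := by
  have h1p : 0 < 1 - p := by linarith
  -- Hölder's inequality with weights `a c`, `b d`, so that the values carry the factors `c⁻¹`, `d⁻¹`.
  have key := ENNReal.inner_le_weight_mul_Lp_of_nonneg (Finset.univ : Finset (Fin 2))
    (p := 1 / (1 - p)) (by rw [le_div_iff₀ h1p]; linarith)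
    ![a * c, b * d] ![A ^ (-p) * c ^ (-1 : ℝ), B ^ (-p) * d ^ (-1 : ℝ)]
  simp only [Fin.sum_univ_two, Matrix.cons_val_zero, Matrix.cons_val_one] at key
  have e1 : ∀ {A c : ℝ≥0∞} {a : ℝ≥0}, c ≠ 0 → c ≠ ⊤ →
      a * c * (A ^ (-p) * c ^ (-1 : ℝ)) = a * A ^ (-p) := by
    intro A c a h h'
    rw [ENNReal.rpow_neg_one]
    calc _ = a * A ^ (-p) * (c * c⁻¹) := by ring
      _ = _ := by rw [ENNReal.mul_inv_cancel h h', mul_one]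
  have e2 : ∀ {A c : ℝ≥0∞} {a : ℝ≥0}, A ≠ 0 → A ≠ ⊤ → c ≠ 0 → c ≠ ⊤ →
      a * c * (A ^ (-p) * c ^ (-1 : ℝ)) ^ (1 / (1 - p)) = a * (A * c) ^ (-(p / (1 - p))) := by
    intro A c a hA hA' h h'
    rw [ENNReal.mul_rpow_of_nonneg _ _ (by positivity), ENNReal.mul_rpow_of_ne_zero hA h,
      ← ENNReal.rpow_mul, ← ENNReal.rpow_mul]
    have : c * c ^ (-1 * (1 / (1 - p))) = c ^ (-(p / (1 - p))) := by
      conv_lhs => rw [← ENNReal.rpow_one c]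
      rw [← ENNReal.rpow_mul, ← ENNReal.rpow_add _ _ h h']
      congr 1; field_simp; ring
    rw [show -p * (1 / (1 - p)) = -(p / (1 - p)) by ring, ← this]
    ring
  rw [e1 hc hc', e1 hd hd', e2 hA hA' hc hc', e2 hB hB' hd hd'] at key
  have x1 : 1 - (1 / (1 - p))⁻¹ = p := by field_simp; ring
  have x2 : (1 / (1 - p))⁻¹ = 1 - p := by simp
  rw [x1, x2] at key
  set X := a * A ^ (-p) + b * B ^ (-p)
  set W := a * c + b * d
  set R := a * (A * c) ^ (-(p / (1 - p))) + b * (B * d) ^ (-(p / (1 - p)))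
  have hW : W ≠ 0 := by simp [W, ha, hc]
  have hW' : W ≠ ⊤ := by simp [W, ENNReal.mul_eq_top, hc', hd']
  have hX : X ≠ 0 := by simp [X, ha, ENNReal.rpow_eq_zero_iff, hA, hA']
  have hX' : X ≠ ⊤ := by
    simp [X, ENNReal.mul_eq_top, ENNReal.rpow_eq_top_iff, hA, hA', hB, hB']
  have h1 : X ^ (1 / (1 - p)) ≤ W ^ (p / (1 - p)) * R := by
    have := ENNReal.rpow_le_rpow key (z := 1 / (1 - p)) (by positivity)
    rw [ENNReal.mul_rpow_of_nonneg _ _ (by positivity), ← ENNReal.rpow_mul,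
      ← ENNReal.rpow_mul, mul_one_div, mul_one_div, div_self h1p.ne', ENNReal.rpow_one] at this
    exact this
  rw [ENNReal.mul_rpow_of_ne_zero (by simp [ENNReal.rpow_eq_zero_iff, hX, hX']) hW,
    ← ENNReal.rpow_mul, show -(1 / p) * -(p / (1 - p)) = 1 / (1 - p) by field_simp,
    ENNReal.rpow_neg W, ← div_eq_mul_inv]
  exact ENNReal.div_le_of_le_mul' h1

/-- The one-dimensional Borell–Brascamp–Lieb inequality with exponent `-p`, for functions with
finite suprema and integrals. -/
theorem borell_brascamp_lieb_real_aux {p : ℝ} (hp : 0 < p) (hp1 : p < 1) {a b : ℝ≥0}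
    (ha : a ≠ 0) (hb : b ≠ 0) {f g h : ℝ → ℝ≥0∞} (hf : Measurable f)
    (hg : Measurable g) (hh : Measurable h) (hf' : ⨆ x, f x ≠ ⊤) (hg' : ⨆ x, g x ≠ ⊤)
    (hfi : ∫⁻ x, f x ≠ ⊤) (hgi : ∫⁻ x, g x ≠ ⊤)
    (H : ∀ x y, h (a • x + b • y) ^ (-p) ≤ a * f x ^ (-p) + b * g y ^ (-p)) :
    (∫⁻ x, h x) ^ (-(p / (1 - p)))
      ≤ a * (∫⁻ x, f x) ^ (-(p / (1 - p))) + b * (∫⁻ x, g x) ^ (-(p / (1 - p))) := by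
  have hq : 0 < p / (1 - p) := div_pos hp (by linarith)
  by_cases hF : ∫⁻ x, f x = 0
  · simp [hF, ENNReal.zero_rpow_of_neg, hq, ha]
  by_cases hG : ∫⁻ x, g x = 0
  · simp [hG, ENNReal.zero_rpow_of_neg, hq, hb]
  have sup_ne : ∀ {f : ℝ → ℝ≥0∞}, ∫⁻ x, f x ≠ 0 → ⨆ x, f x ≠ 0 := by
    intro f hf h0
    exact hf (by simp [fun x => le_antisymm (h0 ▸ le_iSup f x) (zero_le)])
  have hA := sup_ne hF
  have hB := sup_ne hG
  set A := ⨆ x, f x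
  set B := ⨆ x, g x
  set X := a * A ^ (-p) + b * B ^ (-p) with hXdef
  have hX : X ≠ 0 := by simp [X, ha, ENNReal.rpow_eq_zero_iff, hA, hf']
  have hX' : X ≠ ⊤ := by
    simp [X, ENNReal.mul_eq_top, ENNReal.rpow_eq_top_iff, hA, hf', hB, hg']
  set M := X ^ (-(1 / p)) with hM
  have hM0 : M ≠ 0 := by simp [M, ENNReal.rpow_eq_zero_iff, hX, hX']
  have hM' : M ≠ ⊤ := by simp [M, ENNReal.rpow_eq_top_iff, hX, hX']
  -- `M` is the mean of exponent `-p` of the suprema: by homogeneity of that mean, the hypothesis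
  -- for `f / A`, `g / B` and `h / M` takes the form of an inclusion of superlevel sets.
  have level := lintegral_add_le_of_superlevel (hf.div_const A) (hg.div_const B)
    (hh.div_const M) (by rw [← ENNReal.iSup_div]; exact ENNReal.div_self hA hf')
    (by rw [← ENNReal.iSup_div]; exact ENNReal.div_self hB hg') a b (by
      intro x y s hs
      obtain ⟨h1, h2⟩ := lt_min_iff.1 hs
      have hs' : s ≠ ⊤ := h1.ne_top
      rcases eq_or_ne s 0 with rfl | hs0
      · simp
      rw [ENNReal.le_div_iff_mul_le (Or.inl hM0) (Or.inl hM')]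
      refine le_of_rpow_neg_le hp ((H x y).trans ?_)
      have b1 : f x ^ (-p) ≤ (s * A) ^ (-p) :=
        rpow_neg_antitone hp.le (ENNReal.mul_le_of_le_div h1.le)
      have b2 : g y ^ (-p) ≤ (s * B) ^ (-p) :=
        rpow_neg_antitone hp.le (ENNReal.mul_le_of_le_div h2.le)
      calc a * f x ^ (-p) + b * g y ^ (-p)
          ≤ a * (s * A) ^ (-p) + b * (s * B) ^ (-p) := by gcongr
        _ = (s * M) ^ (-p) := by
            rw [ENNReal.mul_rpow_of_ne_zero hs0 hA, ENNReal.mul_rpow_of_ne_zero hs0 hB,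
              ENNReal.mul_rpow_of_ne_zero hs0 hM0, hM, ← ENNReal.rpow_mul,
              show -(1 / p) * -p = 1 by field_simp, ENNReal.rpow_one, hXdef]
            ring)
  simp only [div_eq_mul_inv] at level
  rw [lintegral_mul_const _ hf, lintegral_mul_const _ hg, lintegral_mul_const _ hh] at level
  simp only [← div_eq_mul_inv] at level
  rw [ENNReal.le_div_iff_mul_le (Or.inl hM0) (Or.inl hM'), mul_comm] at level
  refine (rpow_neg_antitone hq.le level).trans ?_
  have := holder_two_point hp hp1 ha hA hf' hB hg'
    (c := (∫⁻ x, f x) / A) (d := (∫⁻ x, g x) / B) (b := b)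
    (ENNReal.div_ne_zero.2 ⟨hF, hf'⟩) (ENNReal.div_ne_top hfi hA)
    (ENNReal.div_ne_zero.2 ⟨hG, hg'⟩) (ENNReal.div_ne_top hgi hB)
  rwa [ENNReal.mul_div_cancel hA hf', ENNReal.mul_div_cancel hB hg'] at this

/-- The truncation of a function at height `N` and to the interval `[-N, N]`. -/
noncomputable def truncation (f : ℝ → ℝ≥0∞) (N : ℕ) : ℝ → ℝ≥0∞ :=
  (Icc (-(N : ℝ)) N).indicator fun x => min (f x) N

theorem truncation_le (f : ℝ → ℝ≥0∞) (N : ℕ) (x : ℝ) : truncation f N x ≤ f x :=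
  indicator_le' (fun _ _ => min_le_left _ _) (fun _ _ => zero_le) x

theorem measurable_truncation {f : ℝ → ℝ≥0∞} (hf : Measurable f) (N : ℕ) :
    Measurable (truncation f N) :=
  (hf.min measurable_const).indicator measurableSet_Icc

theorem iSup_truncation_ne_top (f : ℝ → ℝ≥0∞) (N : ℕ) : ⨆ x, truncation f N x ≠ ⊤ :=
  ne_top_of_le_ne_top (ENNReal.natCast_ne_top N) <| iSup_le
    (indicator_le' (fun _ _ => min_le_right _ _) (fun _ _ => zero_le))

theorem lintegral_truncation_ne_top (f : ℝ → ℝ≥0∞) (N : ℕ) :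
    ∫⁻ x, truncation f N x ≠ ⊤ := by
  have h : ∫⁻ x, truncation f N x ≤ ∫⁻ _ in Icc (-(N : ℝ)) N, (N : ℝ≥0∞) := by
    rw [truncation, lintegral_indicator measurableSet_Icc]
    exact lintegral_mono fun x => min_le_right _ _
  refine ne_top_of_le_ne_top ?_ h
  rw [setLIntegral_const, Real.volume_Icc]
  exact ENNReal.mul_ne_top (ENNReal.natCast_ne_top N) ENNReal.ofReal_ne_top

theorem monotone_truncation (f : ℝ → ℝ≥0∞) (x : ℝ) : Monotone fun N => truncation f N x := by
  intro N M hNM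
  have hc : (N : ℝ) ≤ M := by exact_mod_cast hNM
  refine (indicator_le_indicator_of_subset (Icc_subset_Icc (by linarith) hc)
    (fun _ => zero_le) x).trans (indicator_le_indicator ?_)
  gcongr

theorem tendsto_truncation (f : ℝ → ℝ≥0∞) (x : ℝ) :
    Filter.Tendsto (fun N => truncation f N x) Filter.atTop (nhds (f x)) := by
  have h : Filter.Tendsto (fun N : ℕ => min (f x) N) Filter.atTop (nhds (min (f x) ⊤)) :=
    tendsto_const_nhds.min ENNReal.tendsto_nat_nhds_top
  rw [min_eq_left le_top] at h
  refine h.congr' ?_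
  obtain ⟨M, hM⟩ := exists_nat_ge |x|
  filter_upwards [Filter.eventually_ge_atTop M] with N hN
  have hc : (M : ℝ) ≤ N := by exact_mod_cast hN
  rw [truncation, indicator_of_mem]
  exact abs_le.1 (hM.trans hc)

theorem tendsto_lintegral_truncation {f : ℝ → ℝ≥0∞} (hf : Measurable f) :
    Filter.Tendsto (fun N => ∫⁻ x, truncation f N x) Filter.atTop (nhds (∫⁻ x, f x)) :=
  lintegral_tendsto_of_tendsto_of_monotone (fun N => (measurable_truncation hf N).aemeasurable)
    (ae_of_all _ (monotone_truncation f)) (ae_of_all _ (tendsto_truncation f))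

/-- The one-dimensional Borell–Brascamp–Lieb inequality with exponent `-p`. -/
theorem borell_brascamp_lieb_real {p : ℝ} (hp : 0 < p) (hp1 : p < 1) {a b : ℝ≥0}
    (ha : a ≠ 0) (hb : b ≠ 0) {f g h : ℝ → ℝ≥0∞} (hf : Measurable f)
    (hg : Measurable g) (hh : Measurable h)
    (H : ∀ x y, h (a • x + b • y) ^ (-p) ≤ a * f x ^ (-p) + b * g y ^ (-p)) :
    (∫⁻ x, h x) ^ (-(p / (1 - p)))
      ≤ a * (∫⁻ x, f x) ^ (-(p / (1 - p))) + b * (∫⁻ x, g x) ^ (-(p / (1 - p))) := by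
  have lim : ∀ {f : ℝ → ℝ≥0∞} (a : ℝ≥0), Measurable f →
      Filter.Tendsto (fun N => a * (∫⁻ x, truncation f N x) ^ (-(p / (1 - p)))) Filter.atTop
        (nhds (a * (∫⁻ x, f x) ^ (-(p / (1 - p))))) := fun a hf =>
    ENNReal.Tendsto.const_mul ((ENNReal.continuous_rpow_const.tendsto _).comp
      (tendsto_lintegral_truncation hf)) (Or.inr ENNReal.coe_ne_top)
  refine ge_of_tendsto' ((lim a hf).add (lim b hg)) fun N => ?_
  refine borell_brascamp_lieb_real_aux hp hp1 ha hb (measurable_truncation hf N)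
    (measurable_truncation hg N) hh (iSup_truncation_ne_top f N) (iSup_truncation_ne_top g N)
    (lintegral_truncation_ne_top f N) (lintegral_truncation_ne_top g N) fun x y => ?_
  refine (H x y).trans ?_
  gcongr a * ?_ + b * ?_
  · exact rpow_neg_antitone hp.le (truncation_le f N x)
  · exact rpow_neg_antitone hp.le (truncation_le g N y)

theorem measurable_fin_cons (m : ℕ) :
    Measurable fun q : ℝ × (Fin m → ℝ) => (Fin.cons q.1 q.2 : Fin (m + 1) → ℝ) := by
  refine measurable_pi_iff.2 fun i => ?_
  refine Fin.cases ?_ (fun i => ?_) i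
  · simpa using measurable_fst
  · simpa [Function.comp_def] using (measurable_pi_apply i).comp measurable_snd

theorem lintegral_fin_succ {m : ℕ} {f : (Fin (m + 1) → ℝ) → ℝ≥0∞} (hf : Measurable f) :
    ∫⁻ z, f z = ∫⁻ r : ℝ, ∫⁻ w : Fin m → ℝ, f (Fin.cons r w) := by
  have h := (volume_preserving_piFinSuccAbove (fun _ : Fin (m + 1) => ℝ) 0).symm
  have h' : ∫⁻ z, f z = ∫⁻ q : ℝ × (Fin m → ℝ), f (Fin.cons q.1 q.2) := by
    refine (h.lintegral_map_equiv f).trans (lintegral_congr fun q => ?_)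
    simp [Fin.insertNthEquiv]
  rw [h', Measure.volume_eq_prod, 
    lintegral_prod (fun q : ℝ × (Fin m → ℝ) => f (Fin.cons q.1 q.2))
      (hf.comp (measurable_fin_cons m)).aemeasurable]

/-- The Borell–Brascamp–Lieb inequality in dimension `m` with exponent `-1 / (k + m)`, by
induction on the dimension: integrating out one variable takes `-1 / (j + 1)` to `-1 / j`. -/
theorem borell_brascamp_lieb (m : ℕ) {k : ℕ} (hk : 0 < k) {a b : ℝ≥0}
    (ha : a ≠ 0) (hb : b ≠ 0) {f g h : (Fin m → ℝ) → ℝ≥0∞} (hf : Measurable f)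
    (hg : Measurable g) (hh : Measurable h)
    (H : ∀ x y, h (a • x + b • y) ^ (-(1 / ((k + m : ℕ) : ℝ)))
      ≤ a * f x ^ (-(1 / ((k + m : ℕ) : ℝ))) + b * g y ^ (-(1 / ((k + m : ℕ) : ℝ)))) :
    (∫⁻ x, h x) ^ (-(1 / (k : ℝ)))
      ≤ a * (∫⁻ x, f x) ^ (-(1 / (k : ℝ))) + b * (∫⁻ x, g x) ^ (-(1 / (k : ℝ))) := by
  induction m generalizing k with
  | zero =>
    have e : ∀ f : (Fin 0 → ℝ) → ℝ≥0∞, ∫⁻ x, f x = f 0 := fun f => by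
      rw [lintegral_unique, volume_pi, Measure.pi_univ, Finset.univ_eq_empty, Finset.prod_empty,
        mul_one]
      exact congrArg f (Subsingleton.elim _ _)
    simpa [e] using H 0 0
  | succ m ih =>
    have hk' : (0 : ℝ) < k := by exact_mod_cast hk
    have hcons := measurable_fin_cons m
    have hcons' : ∀ r : ℝ, Measurable fun w : Fin m → ℝ => (Fin.cons r w : Fin (m + 1) → ℝ) :=
      fun r => hcons.comp measurable_prodMk_left
    rw [lintegral_fin_succ hf, lintegral_fin_succ hg, lintegral_fin_succ hh]
    have hq : (1 / ((k + 1 : ℕ) : ℝ)) / (1 - 1 / ((k + 1 : ℕ) : ℝ)) = 1 / (k : ℝ) := by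
      push_cast; field_simp; ring_nf; field_simp
    rw [← hq]
    refine borell_brascamp_lieb_real (by positivity) ?_ ha hb
      (hf.comp hcons).lintegral_prod_right' (hg.comp hcons).lintegral_prod_right'
      (hh.comp hcons).lintegral_prod_right' fun r s => ?_
    · rw [div_lt_one (by positivity)]; push_cast; linarith
    refine ih (Nat.succ_pos k) (hf.comp (hcons' r)) (hg.comp (hcons' s))
      (hh.comp (hcons' _)) fun x y => ?_
    have := H (Fin.cons r x) (Fin.cons s y)
    rw [show a • (Fin.cons r x : Fin (m + 1) → ℝ) + b • (Fin.cons s y : Fin (m + 1) → ℝ)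
      = Fin.cons (a • r + b • s) (a • x + b • y) by
        funext i; refine Fin.cases ?_ (fun i => ?_) i <;> simp] at this
    rwa [show k + 1 + m = k + (m + 1) by ring]

/-! ### Projective coordinates -/

theorem lintegral_eq_two_mul_lintegral_Ioi {Φ : ℝ → ℝ≥0∞} (hΦ : ∀ r, Φ (-r) = Φ r) :
    ∫⁻ r, Φ r = 2 * ∫⁻ r in Ioi (0 : ℝ), Φ r := by
  have h : ∫⁻ r in Iio (0 : ℝ), Φ r = ∫⁻ r in Ioi (0 : ℝ), Φ r := by
    have := (Measure.measurePreserving_neg (volume : Measure ℝ)).setLIntegral_comp_preimage_emb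
      (MeasurableEquiv.neg ℝ).measurableEmbedding Φ (Ioi 0)
    rw [← this]
    simp [hΦ]
  rw [← lintegral_add_compl Φ (measurableSet_Iio (a := (0 : ℝ))), compl_Iio,
    setLIntegral_congr Ioi_ae_eq_Ici.symm, h, two_mul]

theorem lintegral_Ioi_comp_inv (Φ : ℝ → ℝ≥0∞) :
    ∫⁻ r in Ioi (0 : ℝ), Φ r
      = ∫⁻ p in Ioi (0 : ℝ), ENNReal.ofReal p ^ (-2 : ℝ) * Φ p⁻¹ := by
  have himg : (fun p : ℝ => p⁻¹) '' Ioi 0 = Ioi 0 := by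
    ext r
    refine ⟨?_, fun (hr : 0 < r) => ⟨r⁻¹, mem_Ioi.2 (inv_pos.2 hr), inv_inv r⟩⟩
    rintro ⟨p, hp, rfl⟩
    exact mem_Ioi.2 (inv_pos.2 hp)
  have := lintegral_image_eq_lintegral_abs_deriv_mul (s := Ioi 0) measurableSet_Ioi
    (fun p (hp : 0 < p) => (hasDerivAt_inv hp.ne').hasDerivWithinAt)
    inv_injective.injOn Φ
  rw [himg] at this
  rw [this]
  refine setLIntegral_congr_fun measurableSet_Ioi fun p (hp : 0 < p) => ?_
  rw [ENNReal.ofReal_rpow_of_pos hp, abs_neg, abs_of_pos (by positivity),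
    Real.rpow_neg hp.le, Real.rpow_ofNat]

theorem lintegral_comp_inv_smul {m : ℕ} {f : (Fin m → ℝ) → ℝ≥0∞} (hf : Measurable f) {p : ℝ}
    (hp : 0 < p) :
    ∫⁻ w, f w = ENNReal.ofReal p ^ (-(m : ℝ)) * ∫⁻ w, f (p⁻¹ • w) := by
  have hp' : ENNReal.ofReal p ≠ 0 := by simpa using hp
  rw [← lintegral_map hf (measurable_const_smul p⁻¹),
    Measure.map_addHaar_smul _ (inv_ne_zero hp.ne'), lintegral_smul_measure]
  simp only [Module.finrank_fin_fun, inv_pow, inv_inv, smul_eq_mul]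
  rw [abs_of_pos (by positivity), ENNReal.rpow_neg, ENNReal.rpow_natCast,
    ENNReal.ofReal_pow hp.le, ← mul_assoc, ENNReal.inv_mul_cancel (pow_ne_zero _ hp')
      (ENNReal.pow_ne_top ENNReal.ofReal_ne_top), one_mul]

/-- The density of a measure with density `G` on the half-space `{x | ⟪x, θ⟫ > 0}`, in the
projective coordinates `z = (p, w)` with `x = p⁻¹ (θ + L w)`. -/
noncomputable def projDensity {E : Type*} [AddCommGroup E] [Module ℝ E] {m : ℕ} (θ : E)
    (L : (Fin m → ℝ) →ₗ[ℝ] E) (G : E → ℝ≥0∞) : (Fin (m + 1) → ℝ) → ℝ≥0∞ :=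
  {z | 0 < z 0}.indicator fun z =>
    ENNReal.ofReal (z 0) ^ (-((1 + (m + 1) : ℕ) : ℝ)) * G ((z 0)⁻¹ • (θ + L (Fin.tail z)))

theorem measurable_projDensity {E : Type*} [NormedAddCommGroup E] [NormedSpace ℝ E]
    [MeasurableSpace E] [BorelSpace E] [FiniteDimensional ℝ E] {m : ℕ} (θ : E)
    (L : (Fin m → ℝ) →ₗ[ℝ] E) {G : E → ℝ≥0∞} (hG : Measurable G) :
    Measurable (projDensity θ L G) := by
  refine Measurable.indicator (Measurable.mul ?_ (hG.comp ?_))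
    (measurableSet_lt measurable_const (measurable_pi_apply 0))
  · exact ((measurable_pi_apply 0).ennreal_ofReal).pow_const _
  · have hL : Measurable L := L.continuous_of_finiteDimensional.measurable
    have ht : Measurable (fun z : Fin (m + 1) → ℝ => Fin.tail z) :=
      measurable_pi_iff.2 fun i => measurable_pi_apply _
    exact (measurable_pi_apply 0).inv.smul (measurable_const.add (hL.comp ht))

/-- Integration of an even function in the projective coordinates centred at `θ`. -/
theorem exists_lintegral_eq_projDensity {m : ℕ} {θ : EuclideanSpace ℝ (Fin (m + 1))}
    (hθ : ‖θ‖ = 1) :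
    ∃ L : (Fin m → ℝ) →ₗ[ℝ] EuclideanSpace ℝ (Fin (m + 1)), (∀ w, inner ℝ θ (L w) = 0) ∧
      ∀ G : EuclideanSpace ℝ (Fin (m + 1)) → ℝ≥0∞, Measurable G → (∀ x, G (-x) = G x) →
        ∫⁻ x, G x = 2 * ∫⁻ z, projDensity θ L G z := by
  obtain ⟨e, he⟩ := Orthonormal.exists_orthonormalBasis_extension_of_card_eq (𝕜 := ℝ)
    (E := EuclideanSpace ℝ (Fin (m + 1))) (ι := Fin (m + 1)) (by simp) (v := fun _ => θ)
    (s := {0}) (by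
      refine ⟨fun _ => by simpa using hθ, fun i j hij => ?_⟩
      exact absurd (Subsingleton.elim i j) hij)
  have he0 : e 0 = θ := he 0 rfl
  let T : (Fin (m + 1) → ℝ) →ₗ[ℝ] EuclideanSpace ℝ (Fin (m + 1)) :=
    e.repr.symm.toLinearEquiv.toLinearMap ∘ₗ
      (WithLp.linearEquiv 2 ℝ (Fin (m + 1) → ℝ)).symm.toLinearMap
  have hT : MeasurePreserving T := e.measurePreserving_repr_symm.comp
    (PiLp.volume_preserving_toLp (Fin (m + 1)))
  -- `T` is an isometric parametrization whose first coordinate axis is spanned by `θ`.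
  have hTcons : ∀ r w, T (Fin.cons r w) = r • θ + T (Fin.cons 0 w) := by
    intro r w
    have h1 : T (Pi.single 0 1) = θ := by
      rw [← he0]
      simp [T]
    rw [← h1, ← map_smul, ← map_add]
    congr 1
    funext i
    refine Fin.cases ?_ (fun i => ?_) i <;> simp
  let c : (Fin m → ℝ) →ₗ[ℝ] (Fin (m + 1) → ℝ) :=
    { toFun := fun w => Fin.cons 0 w
      map_add' := fun v w => by
        funext i; refine Fin.cases ?_ (fun i => ?_) i <;> simp
      map_smul' := fun r w => by
        funext i; refine Fin.cases ?_ (fun i => ?_) i <;> simp }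
  refine ⟨T ∘ₗ c, fun w => ?_, fun G hG hev => ?_⟩
  · have : inner ℝ (e 0) (T (c w)) = e.repr (T (c w)) 0 := (e.repr_apply_apply _ _).symm
    rw [← he0, LinearMap.comp_apply, this]
    simp [T, c]
  have hGT : Measurable fun z => G (T z) := hG.comp hT.measurable
  set L := T ∘ₗ c with hL
  have hLm : Measurable L := L.continuous_of_finiteDimensional.measurable
  have hsec : ∀ r : ℝ, Measurable fun w => G (r • θ + L w) :=
    fun r => hG.comp (hLm.const_add (r • θ))
  have h1 : ∫⁻ x, G x = ∫⁻ r : ℝ, ∫⁻ w, G (r • θ + L w) := by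
    rw [← hT.lintegral_comp hG, lintegral_fin_succ hGT]
    exact lintegral_congr fun r => lintegral_congr fun w => congrArg G (hTcons r w)
  have h2 : ∀ r : ℝ, ∫⁻ w, G ((-r) • θ + L w) = ∫⁻ w, G (r • θ + L w) := by
    intro r
    rw [← (Measure.measurePreserving_neg (volume : Measure (Fin m → ℝ))).lintegral_comp
      (hsec (-r))]
    refine lintegral_congr fun w => ?_
    rw [← hev, map_neg]
    congr 1
    module
  rw [h1, lintegral_eq_two_mul_lintegral_Ioi h2, lintegral_Ioi_comp_inv,
    lintegral_fin_succ (measurable_projDensity θ L hG), ← lintegral_indicator measurableSet_Ioi]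
  congr 1
  refine lintegral_congr fun p => ?_
  by_cases hp : 0 < p
  · rw [indicator_of_mem (mem_Ioi.2 hp), lintegral_comp_inv_smul (hsec p⁻¹) hp, ← mul_assoc]
    have hp' : ENNReal.ofReal p ≠ 0 := by simpa using hp
    rw [← ENNReal.rpow_add _ _ hp' ENNReal.ofReal_ne_top, ← lintegral_const_mul]
    · refine lintegral_congr fun w => ?_
      rw [projDensity, indicator_of_mem (by simpa using hp)]
      simp only [Fin.cons_zero, Fin.tail_cons, map_smul, smul_add]
      congr 2
      push_cast; ring
    · exact (hsec p⁻¹).comp (measurable_const_smul _)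
  · rw [indicator_of_notMem (mt mem_Ioi.1 hp)]
    simp [projDensity, hp]

theorem projDensity_rpow {E : Type*} [AddCommGroup E] [Module ℝ E] {m : ℕ} (θ : E)
    (L : (Fin m → ℝ) →ₗ[ℝ] E) (G : E → ℝ≥0∞) {z : Fin (m + 1) → ℝ} (hz : 0 < z 0) :
    projDensity θ L G z ^ (-(1 / ((1 + (m + 1) : ℕ) : ℝ)))
      = ENNReal.ofReal (z 0) *
        G ((z 0)⁻¹ • (θ + L (Fin.tail z))) ^ (-(1 / ((1 + (m + 1) : ℕ) : ℝ))) := by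
  have hz' : ENNReal.ofReal (z 0) ≠ 0 := by simpa using hz
  have hn : ((1 + (m + 1) : ℕ) : ℝ) ≠ 0 := by positivity
  rw [projDensity, indicator_of_mem (by exact hz), ENNReal.rpow_neg, ENNReal.rpow_neg,
    ENNReal.mul_rpow_of_nonneg _ _ (by positivity), ENNReal.inv_rpow, ← ENNReal.rpow_mul,
    mul_one_div_cancel hn, ENNReal.rpow_one, ENNReal.mul_inv
      (Or.inl (ENNReal.inv_ne_zero.2 ENNReal.ofReal_ne_top)) (Or.inl (ENNReal.inv_ne_top.2 hz')),
    inv_inv, ENNReal.rpow_neg (G _)]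

/-! ### Densities with negative concavity exponent -/

theorem convexOn_rpow_neg_of_concaveOn_log {E : Type*} [AddCommGroup E] [Module ℝ E] {ψ : E → ℝ}
    {β : ℝ} (hβ : 0 ≤ β) (h : ConcaveOn ℝ {x | 0 < ψ x} fun x => Real.log (ψ x)) :
    ConvexOn ℝ {x | 0 < ψ x} fun x => ψ x ^ (-β) := by
  refine ⟨h.1, fun x hx y hy a b ha hb hab => ?_⟩
  have hz := h.1 hx hy ha hb hab
  have hlog := h.2 hx hy ha hb hab
  simp only [smul_eq_mul, mem_ofPred_eq] at hlog hx hy hz ⊢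
  rw [Real.rpow_def_of_pos hx, Real.rpow_def_of_pos hy, Real.rpow_def_of_pos hz]
  refine le_trans (Real.exp_le_exp.2 ?_)
    (convexOn_exp.2 (mem_univ _) (mem_univ _) ha hb hab)
  simp only [smul_eq_mul]
  nlinarith

theorem concaveOn_log_of_concaveOn_rpow {E : Type*} [AddCommGroup E] [Module ℝ E] {ψ : E → ℝ}
    {γ : ℝ} (hγ : 0 < γ) (h : ConcaveOn ℝ {x | 0 < ψ x} fun x => ψ x ^ γ) :
    ConcaveOn ℝ {x | 0 < ψ x} fun x => Real.log (ψ x) := by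
  refine ⟨h.1, fun x hx y hy a b ha hb hab => ?_⟩
  have hz := h.1 hx hy ha hb hab
  have hpow := h.2 hx hy ha hb hab
  have hlog := strictConcaveOn_log_Ioi.concaveOn.2 (x := ψ x ^ γ) (y := ψ y ^ γ)
    (Real.rpow_pos_of_pos hx γ) (Real.rpow_pos_of_pos hy γ) ha hb hab
  have hpos : 0 < a • ψ x ^ γ + b • ψ y ^ γ :=
    (convex_Ioi 0) (x := ψ x ^ γ) (y := ψ y ^ γ) (Real.rpow_pos_of_pos hx γ)
      (Real.rpow_pos_of_pos hy γ) ha hb hab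
  have hle := hlog.trans (Real.log_le_log hpos hpow)
  simp only [smul_eq_mul, mem_ofPred_eq] at hle hx hy hz ⊢
  rw [Real.log_rpow hx, Real.log_rpow hy, Real.log_rpow hz] at hle
  exact le_of_mul_le_mul_left (by linarith) hγ

/-- A `γ`-concave function is `-β`-concave for every `β > 0` with `-β ≤ γ`. -/
theorem IsGammaConcave.convexOn_rpow_neg {E : Type*} [AddCommGroup E] [Module ℝ E] {ψ : E → ℝ}
    {γ β : ℝ} (hψ : IsGammaConcave γ ψ) (hβ : 0 < β) (hγ : -β ≤ γ) :
    ConvexOn ℝ {x | 0 < ψ x} fun x => ψ x ^ (-β) := by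
  obtain ⟨-, -, hpos, hzero, hneg⟩ := hψ
  rcases lt_trichotomy γ 0 with h | h | h
  · have hc := hneg h
    refine ⟨hc.1, fun x hx y hy a b ha hb hab => ?_⟩
    have hz := hc.1 hx hy ha hb hab
    have hpow := hc.2 hx hy ha hb hab
    have he : 1 ≤ β / -γ := by rw [le_div_iff₀ (by linarith)]; linarith
    have hβγ : γ * (β / -γ) = -β := by
      have := h.ne
      field_simp
    have hrw : ∀ {x}, 0 < ψ x → ψ x ^ (-β) = (ψ x ^ γ) ^ (β / -γ) := fun hx => by
      rw [← Real.rpow_mul (le_of_lt hx), hβγ]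
    simp only
    rw [hrw hx, hrw hy, hrw hz]
    exact (Real.rpow_le_rpow (Real.rpow_nonneg (le_of_lt hz) _) hpow (by linarith)).trans
      ((convexOn_rpow he).2 (x := ψ x ^ γ) (y := ψ y ^ γ) (Real.rpow_nonneg (le_of_lt hx) _)
        (Real.rpow_nonneg (le_of_lt hy) _) ha hb hab)
  · exact convexOn_rpow_neg_of_concaveOn_log hβ.le (hzero h)
  · exact convexOn_rpow_neg_of_concaveOn_log hβ.le (concaveOn_log_of_concaveOn_rpow h (hpos h))

/-- The density `ψ`, set to zero off the interior of `{ψ > 0}`. For a `γ`-concave `ψ` this changes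
`ψ` on a null set only and makes it measurable. -/
noncomputable def interiorDensity {E : Type*} [TopologicalSpace E] (ψ : E → ℝ) : E → ℝ≥0∞ :=
  (interior {x | 0 < ψ x}).indicator fun x => ENNReal.ofReal (ψ x)

section InteriorDensity
variable {E : Type*} [NormedAddCommGroup E] {ψ : E → ℝ}

theorem pos_of_mem_interior {x : E} (hx : x ∈ interior {x | 0 < ψ x}) : 0 < ψ x :=
  interior_subset (s := {x | 0 < ψ x}) hx

theorem interiorDensity_neg (heven : ∀ x, ψ (-x) = ψ x) (x : E) :
    interiorDensity ψ (-x) = interiorDensity ψ x := by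
  have hS : -{x | 0 < ψ x} = {x | 0 < ψ x} := by
    ext x; simp [heven]
  have hmem : -x ∈ interior {x | 0 < ψ x} ↔ x ∈ interior {x | 0 < ψ x} := by
    have := (Homeomorph.neg E).preimage_interior {x | 0 < ψ x}
    rw [Homeomorph.coe_neg, neg_preimage, neg_preimage, hS] at this
    rw [← mem_neg, this]
  by_cases hx : x ∈ interior {x | 0 < ψ x}
  · rw [interiorDensity, indicator_of_mem hx, indicator_of_mem (hmem.2 hx), heven]
  · rw [interiorDensity, indicator_of_notMem hx, indicator_of_notMem (mt hmem.1 hx)]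

variable [NormedSpace ℝ E] {β : ℝ}

theorem measurable_interiorDensity [FiniteDimensional ℝ E] [MeasurableSpace E] [BorelSpace E]
    (hβ : 0 < β) (h : ConvexOn ℝ {x | 0 < ψ x} fun x => ψ x ^ (-β)) :
    Measurable (interiorDensity ψ) := by
  refine measurable_of_restrict_of_restrict_compl (s := interior {x | 0 < ψ x})
    isOpen_interior.measurableSet ?_ ?_
  -- A convex function is continuous in the interior of its domain.
  · have hc : ContinuousOn (fun x => ENNReal.ofReal ((ψ x ^ (-β)) ^ (-β)⁻¹))
        (interior {x | 0 < ψ x}) := by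
      refine ENNReal.continuous_ofReal.comp_continuousOn
        (h.continuousOn_interior.rpow_const fun x hx => Or.inl ?_)
      exact (Real.rpow_pos_of_pos (pos_of_mem_interior hx) _).ne'
    convert (continuousOn_iff_continuous_domRestrict.1 hc).measurable using 1
    ext ⟨x, hx⟩
    rw [domRestrict_apply, domRestrict_apply, interiorDensity, indicator_of_mem hx,
      Real.rpow_rpow_inv (pos_of_mem_interior hx).le (neg_ne_zero.2 hβ.ne')]
  · convert measurable_const (a := (0 : ℝ≥0∞)) using 1
    ext ⟨x, hx⟩
    rw [domRestrict_apply, interiorDensity, indicator_of_notMem hx]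

theorem interiorDensity_ae_eq [FiniteDimensional ℝ E] [MeasurableSpace E] [BorelSpace E]
    (μ : Measure E) [μ.IsAddHaarMeasure] (hconv : Convex ℝ {x | 0 < ψ x}) :
    (fun x => ENNReal.ofReal (ψ x)) =ᵐ[μ] interiorDensity ψ := by
  have hf : ∀ᵐ x ∂μ, x ∉ frontier {x | 0 < ψ x} := by
    rw [ae_iff]
    simpa using hconv.addHaar_frontier μ
  filter_upwards [hf] with x hx
  rw [interiorDensity]
  by_cases hi : x ∈ interior {x | 0 < ψ x}
  · rw [indicator_of_mem hi]
  · rw [indicator_of_notMem hi, ENNReal.ofReal_eq_zero]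
    by_contra hpos
    exact hx ⟨subset_closure (not_le.1 hpos), hi⟩

theorem interiorDensity_rpow_le (hβ : 0 < β)
    (h : ConvexOn ℝ {x | 0 < ψ x} fun x => ψ x ^ (-β)) {c d : ℝ≥0} (hc : c ≠ 0) (hd : d ≠ 0)
    (hcd : c + d = 1) (x y : E) :
    interiorDensity ψ (c • x + d • y) ^ (-β)
      ≤ c * interiorDensity ψ x ^ (-β) + d * interiorDensity ψ y ^ (-β) := by
  by_cases hx : x ∈ interior {x | 0 < ψ x}
  swap
  · simp [interiorDensity, hx, ENNReal.zero_rpow_of_neg, hβ, hc]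
  by_cases hy : y ∈ interior {x | 0 < ψ x}
  swap
  · simp [interiorDensity, hy, ENNReal.zero_rpow_of_neg, hβ, hd]
  have hcd' : (c : ℝ) + d = 1 := by exact_mod_cast hcd
  have hz : c • x + d • y ∈ interior {x | 0 < ψ x} :=
    h.1.interior hx hy c.coe_nonneg d.coe_nonneg hcd'
  have hconv := h.2 (interior_subset hx) (interior_subset hy) c.coe_nonneg d.coe_nonneg hcd'
  rw [interiorDensity, indicator_of_mem hx, indicator_of_mem hy, indicator_of_mem hz,
    ENNReal.ofReal_rpow_of_pos (pos_of_mem_interior hx), ENNReal.ofReal_rpow_of_pos (pos_of_mem_interior hy),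
    ENNReal.ofReal_rpow_of_pos (pos_of_mem_interior hz), ← ENNReal.ofReal_coe_nnreal,
    ← ENNReal.ofReal_coe_nnreal, ← ENNReal.ofReal_mul c.coe_nonneg, ← ENNReal.ofReal_mul d.coe_nonneg]
  have hxn : 0 ≤ ψ x ^ (-β) := Real.rpow_nonneg (pos_of_mem_interior hx).le _
  have hyn : 0 ≤ ψ y ^ (-β) := Real.rpow_nonneg (pos_of_mem_interior hy).le _
  rw [← ENNReal.ofReal_add (mul_nonneg c.coe_nonneg hxn) (mul_nonneg d.coe_nonneg hyn)]
  exact ENNReal.ofReal_le_ofReal hconv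

end InteriorDensity

/-! ### Polars of shadow systems -/

section Polar
variable {E : Type*} [NormedAddCommGroup E] [InnerProductSpace ℝ E]

theorem isClosed_polar (K : Set E) : IsClosed (polar K) := by
  have : polar K = ⋂ x ∈ K, {y | inner ℝ x y ≤ (1 : ℝ)} := by
    ext y; simp [mem_polar_iff]
  rw [this]
  exact isClosed_biInter fun x _ => isClosed_le (by fun_prop) continuous_const

theorem neg_mem_polar_iff {K : Set E} (hK : -K = K) (y : E) : -y ∈ polar K ↔ y ∈ polar K := by
  simp only [mem_polar_iff, inner_neg_right]
  refine ⟨fun h x hx => ?_, fun h x hx => ?_⟩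
  · simpa using h (-x) (by rwa [← mem_neg, hK])
  · simpa using h (-x) (by rwa [← mem_neg, hK])

/-- In projective coordinates `(p, w)`, the polar of `P_t C` is cut out by inequalities which are
jointly affine in `(p, w, t)`. -/
theorem inv_smul_mem_polar_shadow_iff {θ v : E} (hθ : ‖θ‖ = 1) (hv : inner ℝ θ v = (0 : ℝ))
    (C : Set (E × ℝ)) (t : ℝ) {p : ℝ} (hp : 0 < p) :
    p⁻¹ • (θ + v) ∈ polar (shadowProj θ t '' C) ↔
      ∀ q ∈ C, inner ℝ q.1 (θ + v) + t * q.2 ≤ p := by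
  rw [mem_polar_iff, forall_mem_image]
  refine forall₂_congr fun q _ => ?_
  rw [shadowProj, inner_smul_right, inner_add_left, real_inner_smul_left, inner_add_right θ,
    hv, real_inner_self_eq_norm_sq, hθ, inv_mul_le_iff₀ hp]
  simp

theorem projDensity_of_nonpos {m : ℕ} (θ : E) (L : (Fin m → ℝ) →ₗ[ℝ] E) (G : E → ℝ≥0∞)
    {z : Fin (m + 1) → ℝ} (hz : z 0 ≤ 0) : projDensity θ L G z = 0 :=
  indicator_of_notMem (s := {z : Fin (m + 1) → ℝ | 0 < z 0}) (not_lt.2 hz) _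

/-- The densities of the measures of the polars `(P_t C)°`, in projective coordinates, are jointly
concave in the coordinates and `t`, with the exponent of the Borell–Brascamp–Lieb inequality. -/
theorem projDensity_polar_rpow_le {m : ℕ} {θ : E} (hθ : ‖θ‖ = 1) {L : (Fin m → ℝ) →ₗ[ℝ] E}
    (hL : ∀ w, inner ℝ θ (L w) = (0 : ℝ)) (C : Set (E × ℝ)) {g : E → ℝ≥0∞}
    (hg : ∀ c d : ℝ≥0, c ≠ 0 → d ≠ 0 → c + d = 1 → ∀ x y,
      g (c • x + d • y) ^ (-(1 / ((1 + (m + 1) : ℕ) : ℝ)))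
        ≤ c * g x ^ (-(1 / ((1 + (m + 1) : ℕ) : ℝ))) + d * g y ^ (-(1 / ((1 + (m + 1) : ℕ) : ℝ))))
    {a b : ℝ≥0} (ha : a ≠ 0) (hb : b ≠ 0) (hab : a + b = 1) (s t : ℝ)
    (y z : Fin (m + 1) → ℝ) :
    projDensity θ L ((polar (shadowProj θ (a • s + b • t) '' C)).indicator g) (a • y + b • z)
        ^ (-(1 / ((1 + (m + 1) : ℕ) : ℝ)))
      ≤ a * projDensity θ L ((polar (shadowProj θ s '' C)).indicator g) y
          ^ (-(1 / ((1 + (m + 1) : ℕ) : ℝ)))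
        + b * projDensity θ L ((polar (shadowProj θ t '' C)).indicator g) z
          ^ (-(1 / ((1 + (m + 1) : ℕ) : ℝ))) := by
  have hβ : 0 < 1 / ((1 + (m + 1) : ℕ) : ℝ) := by positivity
  -- Where one of the two densities vanishes, the right-hand side is infinite.
  by_cases hy : 0 < y 0
  swap
  · rw [projDensity_of_nonpos θ L _ (not_lt.1 hy),
      ENNReal.zero_rpow_of_neg (neg_neg_of_pos hβ)]
    simp [ha]
  by_cases hz : 0 < z 0
  swap
  · rw [projDensity_of_nonpos θ L _ (not_lt.1 hz),
      ENNReal.zero_rpow_of_neg (neg_neg_of_pos hβ)]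
    simp [hb]
  have ha' : (0 : ℝ) < a := by positivity
  have hb' : (0 : ℝ) < b := by positivity
  have hp0 : (a • y + b • z) 0 = a * y 0 + b * z 0 := rfl
  have hp : 0 < (a • y + b • z) 0 := by rw [hp0]; positivity
  rw [projDensity_rpow θ L _ hy, projDensity_rpow θ L _ hz, projDensity_rpow θ L _ hp]
  by_cases hyK : (y 0)⁻¹ • (θ + L (Fin.tail y)) ∈ polar (shadowProj θ s '' C)
  swap
  · rw [indicator_of_notMem hyK, ENNReal.zero_rpow_of_neg (neg_neg_of_pos hβ),
      ENNReal.mul_top (by simpa using hy), ENNReal.mul_top (by simpa using ha), top_add]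
    exact le_top
  by_cases hzK : (z 0)⁻¹ • (θ + L (Fin.tail z)) ∈ polar (shadowProj θ t '' C)
  swap
  · rw [indicator_of_notMem hzK, ENNReal.zero_rpow_of_neg (neg_neg_of_pos hβ),
      ENNReal.mul_top (by simpa using hz), ENNReal.mul_top (by simpa using hb), add_top]
    exact le_top
  have htail : θ + L (Fin.tail (a • y + b • z))
      = (a : ℝ) • (θ + L (Fin.tail y)) + (b : ℝ) • (θ + L (Fin.tail z)) := by
    have h1 : Fin.tail (a • y + b • z) = (a : ℝ) • Fin.tail y + (b : ℝ) • Fin.tail z := rfl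
    have h2 : θ = ((a : ℝ) + b) • θ := by
      rw [show (a : ℝ) + b = 1 by exact_mod_cast hab, one_smul]
    rw [h1, map_add, map_smul, map_smul]
    nth_rewrite 1 [h2]
    module
  have hK : ((a • y + b • z) 0)⁻¹ • (θ + L (Fin.tail (a • y + b • z)))
      ∈ polar (shadowProj θ (a • s + b • t) '' C) := by
    rw [inv_smul_mem_polar_shadow_iff hθ (hL _) C _ hp]
    rw [inv_smul_mem_polar_shadow_iff hθ (hL _) C _ hy] at hyK
    rw [inv_smul_mem_polar_shadow_iff hθ (hL _) C _ hz] at hzK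
    intro q hq
    have h1 := mul_le_mul_of_nonneg_left (hyK q hq) ha'.le
    have h2 := mul_le_mul_of_nonneg_left (hzK q hq) hb'.le
    rw [htail, inner_add_right, real_inner_smul_right, real_inner_smul_right, hp0]
    simp only [NNReal.smul_def, smul_eq_mul]
    linarith
  rw [indicator_of_mem hyK, indicator_of_mem hzK, indicator_of_mem hK]
  set p : ℝ := (a • y + b • z) 0
  -- The perspective of a convex function: the weights are proportional to the values of `p`.
  have hYp : (0 : ℝ) ≤ a * y 0 / p := by positivity
  have hZp : (0 : ℝ) ≤ b * z 0 / p := by positivity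
  have hc : (a * y 0 / p).toNNReal ≠ 0 := by
    simp only [ne_eq, Real.toNNReal_eq_zero, not_le]; positivity
  have hd : (b * z 0 / p).toNNReal ≠ 0 := by
    simp only [ne_eq, Real.toNNReal_eq_zero, not_le]; positivity
  have hcd : (a * y 0 / p).toNNReal + (b * z 0 / p).toNNReal = 1 := by
    rw [← Real.toNNReal_add hYp hZp, ← add_div, ← hp0, div_self hp.ne', Real.toNNReal_one]
  have hgc := hg _ _ hc hd hcd ((y 0)⁻¹ • (θ + L (Fin.tail y))) ((z 0)⁻¹ • (θ + L (Fin.tail z)))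
  have hpt : (a * y 0 / p).toNNReal • ((y 0)⁻¹ • (θ + L (Fin.tail y)))
      + (b * z 0 / p).toNNReal • ((z 0)⁻¹ • (θ + L (Fin.tail z)))
      = p⁻¹ • (θ + L (Fin.tail (a • y + b • z))) := by
    rw [htail, NNReal.smul_def, NNReal.smul_def, Real.coe_toNNReal _ hYp, Real.coe_toNNReal _ hZp,
      smul_smul, smul_smul, smul_add p⁻¹, smul_smul, smul_smul]
    congr 2 <;> field_simp
  rw [hpt] at hgc
  refine (mul_le_mul_right hgc _).trans_eq ?_
  have hmul : ∀ {r : ℝ} (a : ℝ≥0), 0 < r → ENNReal.ofReal p * ((a * r / p).toNNReal : ℝ≥0∞)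
      = a * ENNReal.ofReal r := by
    intro r a hr
    rw [← ENNReal.ofReal_coe_nnreal (p := a)]
    change _ * ENNReal.ofReal _ = _
    rw [← ENNReal.ofReal_mul hp.le, mul_div_cancel₀ _ hp.ne', ENNReal.ofReal_mul a.coe_nonneg]
  rw [mul_add, ← mul_assoc, ← mul_assoc, hmul a hy, hmul b hz, mul_assoc, mul_assoc]

end Polar

end CampiGronchi

/-- Convexity of `t ↦ ν(K_t°)⁻¹` is that of a function with values in `[0, ∞]`, where `0⁻¹ = ∞`
and `∞⁻¹ = 0`; the scalars are the nonnegative reals since these are what acts on `[0, ∞]`. -/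
theorem mainTheorem3 (n : ℕ) (ν : Measure (EuclideanSpace ℝ (Fin n)))
    (ψ : EuclideanSpace ℝ (Fin n) → ℝ)
    (hν : ν = (volume : Measure (EuclideanSpace ℝ (Fin n))).withDensity
      (fun x => ENNReal.ofReal (ψ x)))
    (heven : ∀ x, ψ (-x) = ψ x)
    (γ : ℝ) (hγ : -1 / ((n : ℝ) + 1) ≤ γ)
    (hψ : CampiGronchi.IsGammaConcave γ ψ)
    (K : ℝ → Set (EuclideanSpace ℝ (Fin n)))
    (hK : CampiGronchi.IsShadowSystem K)
    (hsymm : ∀ t, -(K t) = K t) :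
    ConvexOn ℝ≥0 (Set.univ : Set ℝ) (fun t : ℝ => (ν (CampiGronchi.polar (K t)))⁻¹) := by
  open CampiGronchi in
  obtain ⟨C, θ, -, -, hθ, hKC⟩ := hK
  -- In dimension zero there is no unit vector.
  obtain _ | m := n
  · simp [Subsingleton.elim θ 0] at hθ
  have hconv := hψ.convexOn_rpow_neg (β := 1 / ((1 + (m + 1) : ℕ) : ℝ)) (by positivity) (by
    refine le_of_eq_of_le ?_ hγ
    push_cast; ring)
  have hgm := measurable_interiorDensity (by positivity) hconv
  have hKm : ∀ t, MeasurableSet (polar (K t)) := fun t => (isClosed_polar _).measurableSet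
  obtain ⟨L, hL, hint⟩ := exists_lintegral_eq_projDensity hθ
  have hνK : ∀ t, ν (polar (K t))
      = 2 * ∫⁻ z, projDensity θ L ((polar (K t)).indicator (interiorDensity ψ)) z := by
    intro t
    rw [hν, withDensity_congr_ae (interiorDensity_ae_eq volume hconv.1),
      withDensity_apply _ (hKm t), ← lintegral_indicator (hKm t)]
    refine hint _ (hgm.indicator (hKm t)) fun x => ?_
    by_cases hx : x ∈ polar (K t)
    · rw [indicator_of_mem hx, indicator_of_mem ((neg_mem_polar_iff (hsymm t) x).2 hx),
        interiorDensity_neg heven]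
    · rw [indicator_of_notMem hx, indicator_of_notMem (mt (neg_mem_polar_iff (hsymm t) x).1 hx)]
  refine ⟨convex_univ, fun s _ t _ a b _ _ hab => ?_⟩
  -- Zero weights are treated apart: a zero weight on an infinite value counts as zero.
  rcases eq_or_ne a 0 with rfl | ha
  · obtain rfl : b = 1 := by simpa using hab
    simp
  rcases eq_or_ne b 0 with rfl | hb
  · obtain rfl : a = 1 := by simpa using hab
    simp
  have hmeas : ∀ t, Measurable (projDensity θ L ((polar (K t)).indicator (interiorDensity ψ))) :=
    fun t => measurable_projDensity θ L (hgm.indicator (hKm t))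
  -- The exponent `-1 / (n + 1)` in dimension `n` becomes `-1` after integration.
  have main := borell_brascamp_lieb (m + 1) one_pos ha hb (hmeas s) (hmeas t)
    (hmeas (a • s + b • t)) (fun y z => by
      simp only [hKC]
      exact projDensity_polar_rpow_le hθ hL C (fun c d hc hd hcd x y =>
        interiorDensity_rpow_le (by positivity) hconv hc hd hcd x y) ha hb hab s t y z)
  simp only [Nat.cast_one, div_one, ENNReal.rpow_neg_one] at main
  simp only [hνK, ENNReal.smul_def, smul_eq_mul]
  rw [ENNReal.mul_inv (by simp) (by simp), ENNReal.mul_inv (by simp) (by simp),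
    ENNReal.mul_inv (by simp) (by simp)]
  calc _ ≤ 2⁻¹ * _ := mul_le_mul_right main _
    _ = _ := by ring
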